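/- For a finite set $X$ let $\mathrm{SIM}(X)$ be the symmetric inverse monoid on $X$, i.e. the monoid of all partial one-to-one maps from $X$ to itself under composition. For $\sigma\in\mathrm{SIM}(X)$ and a positive integer $k$, let $r_k(\sigma)$ be the number of $\alpha\in\mathrm{SIM}(X)$ with $\alpha^k=\sigma$. A path $[a_1a_2\cdots a_\ell]$ of length $\ell\ge 1$, where $a_1,\dots,a_\ell\in X$ are distinct (its digits), maps $a_1\mapsto a_2\mapsto\cdots\mapsto a_\ell$, maps $a_\ell$ to nothing, and, as a factor of a product, fixes the elements of $X$ that are not its digits. For an integer partition $\lambda$ let $\ell(\lambda)$ be its number of parts, $\sum\lambda$ the sum of its parts, $\max\lambda$ its largest part, and $\mathrm{freq}(a,\lambda)$ the number of times $a$ occurs as a part; $\prod_{a\in\lambda}$ denotes the product over the distinct parts of $\lambda$. The empty partition, a partition of $0$, is allowed, and $\max\lambda\le k$ holds for it. Theorem 4. Let $k\ge 1$ and $m\ge 2$ be integers, let $n_1,\dots,n_m$ be nonnegative integers, and let $$\sigma=\sigma_{11}\cdots\sigma_{1n_1}\,\sigma_{21}\cdots\sigma_{2n_2}\cdots\sigma_{m1}\cdots\sigma_{mn_m}\in\mathrm{SIM}(X),$$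 where the $\sigma_{ij}$ are pairwise disjoint paths, $\sigma_{ij}$ has length $m+1-i$ for all $i,j$, and every element of $X$ is a digit of one of the $\sigma_{ij}$. Then $$r_k(\sigma)=\sum_{\lambda_1,\dots,\lambda_m}\frac{n_1!\cdots n_m!}{\prod_{i=1}^m\prod_{a\in\lambda_i}\mathrm{freq}(a,\lambda_i)!},$$ where the sum is taken over all sequences of integer partitions $\lambda_1,\dots,\lambda_m$ such that, for $1\le i\le m$, $\lambda_i$ is a partition of $\sum_{j=1}^{i}n_j-k\sum_{j=1}^{i-1}\ell(\lambda_j)$ and $\max\lambda_i\le k$, and, for $1\le i\le m-1$, $\ell(\lambda_i)\le (n_{i+1}+\sum\lambda_i)/k$. -/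

import Mathlib

/-- The symmetric inverse monoid on `X`: all partial one-to-one maps from `X` to itself. -/
abbrev SIM (X : Type*) := X ≃. X

/-- `SIM X` is a monoid under composition, `(f * g) x = f (g x)`. -/
instance SIM.instMonoid {X : Type*} : Monoid (SIM X) where
  mul f g := g.trans f
  one := PEquiv.refl X
  mul_assoc f g h := (PEquiv.trans_assoc h g f).symm
  one_mul f := PEquiv.trans_refl f
  mul_one f := PEquiv.refl_trans f

/-- The number `r_k(σ)` of `k`th roots of `σ` in `SIM X`. -/
noncomputable def SIM.rootCount {X : Type*} (k : ℕ) (σ : SIM X) : ℕ :=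
  Nat.card {α : SIM X // α ^ k = σ}

/-- The data of a path `[a₁ a₂ ⋯ a_ℓ]` in `X`: a nonempty list of distinct digits. -/
structure SimPath (X : Type*) where
  digits : List X
  nodup : digits.Nodup
  ne_nil : digits ≠ []

/-- The length of a path is its number of digits. -/
def SimPath.length {X : Type*} (p : SimPath X) : ℕ := p.digits.length

/-- The single path element: `a₁ ↦ a₂ ↦ ⋯ ↦ a_ℓ`, the last digit `a_ℓ` is mapped to nothing,
and (as for cycles) an element which is not a digit is fixed, so that the composite of disjoint
paths acts on the digits of each of them as that path does. -/
def SimPath.toSIM {X : Type*} [DecidableEq X] (p : SimPath X) : SIM X where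
  toFun x := if x ∈ p.digits then p.digits[p.digits.idxOf x + 1]? else some x
  invFun y := if y ∈ p.digits then
      (if p.digits.idxOf y = 0 then none else p.digits[p.digits.idxOf y - 1]?)
    else some y
  inv x y := by
    obtain ⟨l, hl, -⟩ := p
    have key : ∀ (i : ℕ) (z : X), l[i]? = some z ↔ z ∈ l ∧ l.idxOf z = i := by
      intro i z
      constructor
      · intro h
        obtain ⟨hi, rfl⟩ := List.getElem?_eq_some_iff.1 h
        exact ⟨List.getElem_mem hi, hl.idxOf_getElem i hi⟩
      · rintro ⟨hz, rfl⟩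
        exact List.getElem?_idxOf hz
    dsimp only
    split_ifs with hy h0 hx hx hx
    · simp only [key]
      constructor
      · simp
      · rintro ⟨_, h⟩; omega
    · simp only [Option.some.injEq, false_iff]
      rintro rfl; exact hx hy
    · simp only [key]
      constructor
      · rintro ⟨_, h⟩; exact ⟨hy, by omega⟩
      · rintro ⟨_, h⟩; exact ⟨hx, by omega⟩
    · simp only [key, Option.some.injEq]
      constructor
      · rintro ⟨h, _⟩; exact absurd h hx
      · rintro rfl; exact absurd hy hx
    · simp only [key, Option.some.injEq]
      constructor
      · rintro rfl; exact absurd hx hy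
      · rintro ⟨h, _⟩; exact absurd h hy
    · simp only [Option.some.injEq]; exact eq_comm

/-- Integer partitions of arbitrary nonnegative integers; `l.1` is the number `∑ λ` which is
partitioned and `l.2.parts` is the multiset of the (positive) parts. -/
abbrev IntPartition := Σ s : ℕ, s.Partition

/-- The number `ℓ(λ)` of parts. -/
def IntPartition.length (l : IntPartition) : ℕ := Multiset.card l.2.parts

/-- `freq(a, λ)`, the number of times `a` occurs as a part. -/
def IntPartition.freq (a : ℕ) (l : IntPartition) : ℕ := l.2.parts.count a

/-- The product of `freq(a, λ)!` over the distinct parts `a` of `λ`. -/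
def IntPartition.freqFactorialProd (l : IntPartition) : ℕ :=
  ∏ a ∈ l.2.parts.toFinset, (IntPartition.freq a l).factorial

/-- The constraints on the partitions `λ₁, …, λ_m` (here indexed from `0` to `m - 1`). -/
structure IsAdmissibleChain (k : ℕ) {m : ℕ} (n : Fin m → ℕ) (lam : Fin m → IntPartition) :
    Prop where
  /-- `λ_i ⊢ n₁ + ⋯ + n_i - k (ℓ(λ₁) + ⋯ + ℓ(λ_{i-1}))` -/
  sum_eq : ∀ i, (lam i).1 + k * ∑ j ∈ Finset.Iio i, IntPartition.length (lam j)
    = ∑ j ∈ Finset.Iic i, n j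
  /-- `max λ_i ≤ k` -/
  max_le : ∀ i, ∀ a ∈ (lam i).2.parts, a ≤ k
  /-- `ℓ(λ_i) ≤ (n_{i+1} + ∑ λ_i) / k` whenever `n_{i+1}` exists -/
  length_le : ∀ i j : Fin m, j.val = i.val + 1 →
    k * IntPartition.length (lam i) ≤ n j + (lam i).1

theorem finite_admissibleChains (k : ℕ) {m : ℕ} (n : Fin m → ℕ) :
    {lam : Fin m → IntPartition | IsAdmissibleChain k n lam}.Finite := by
  have h1 : {l : IntPartition | l.1 ≤ ∑ i, n i}.Finite := by
    have : {l : IntPartition | l.1 ≤ ∑ i, n i}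
        ⊆ Set.range (fun q : Σ s : Fin (∑ i, n i + 1), (s : ℕ).Partition =>
          (⟨q.1, q.2⟩ : IntPartition)) := by
      rintro ⟨s, l⟩ hs
      exact ⟨⟨⟨s, Nat.lt_succ_of_le hs⟩, l⟩, rfl⟩
    exact (Set.finite_range _).subset this
  refine (Set.Finite.pi' (fun _ : Fin m => h1)).subset fun lam h i => ?_
  have h2 := h.sum_eq i
  have h3 : ∑ j ∈ Finset.Iic i, n j ≤ ∑ j, n j :=
    Finset.sum_le_sum_of_subset (Finset.subset_univ _)
  show (lam i).1 ≤ ∑ j, n j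
  omega

/-- The finite set of all admissible chains of partitions. -/
noncomputable def admissibleChains (k : ℕ) {m : ℕ} (n : Fin m → ℕ) :
    Finset (Fin m → IntPartition) :=
  (finite_admissibleChains k n).toFinset

namespace SIM

variable {X Y : Type*}

theorem mem_mul {f g : SIM X} {x z : X} : z ∈ (f * g) x ↔ ∃ y, y ∈ g x ∧ z ∈ f y :=
  PEquiv.mem_trans g f x z

theorem mem_one {x y : X} : y ∈ (1 : SIM X) x ↔ x = y :=
  Option.some_inj

theorem ext_mem {α β : SIM X} (h : ∀ x y, y ∈ α x ↔ y ∈ β x) : α = β :=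
  PEquiv.ext fun x => Option.ext fun y => h x y

/-- Transport of partial one-to-one maps along a bijection. -/
def conj (e : X ≃ Y) (α : SIM X) : SIM Y :=
  e.symm.toPEquiv.trans (α.trans e.toPEquiv)

theorem mem_conj {e : X ≃ Y} {α : SIM X} {x y : Y} :
    y ∈ conj e α x ↔ e.symm y ∈ α (e.symm x) := by
  unfold conj
  simp only [PEquiv.mem_trans, Equiv.toPEquiv_apply, Option.mem_some_iff]
  constructor
  · rintro ⟨_, rfl, b, hb, rfl⟩
    simpa using hb
  · intro h
    exact ⟨_, rfl, _, h, by simp⟩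

theorem conj_eq_iff {e : X ≃ Y} {α : SIM X} {β : SIM Y} :
    conj e α = β ↔ ∀ x y, e y ∈ β (e x) ↔ y ∈ α x := by
  constructor
  · rintro rfl x y
    rw [mem_conj, e.symm_apply_apply, e.symm_apply_apply]
  · intro h
    refine ext_mem fun x y => ?_
    rw [mem_conj, ← h]
    simp

theorem conj_mul (e : X ≃ Y) (α β : SIM X) : conj e (α * β) = conj e α * conj e β := by
  refine ext_mem fun x z => ?_
  simp only [mem_conj, mem_mul]
  constructor
  · rintro ⟨y, hy, hz⟩
    exact ⟨e y, by simpa using hy, by simpa using hz⟩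
  · rintro ⟨y, hy, hz⟩
    exact ⟨_, hy, hz⟩

theorem conj_one (e : X ≃ Y) : conj e (1 : SIM X) = 1 := by
  refine ext_mem fun x z => ?_
  simp only [mem_conj, mem_one, EmbeddingLike.apply_eq_iff_eq]

theorem conj_pow (e : X ≃ Y) (α : SIM X) (k : ℕ) : conj e (α ^ k) = conj e α ^ k := by
  induction k with
  | zero => simp [conj_one]
  | succ k ih => rw [pow_succ, pow_succ, conj_mul, ih]

theorem conj_trans {Z : Type*} (e : X ≃ Y) (e' : Y ≃ Z) (α : SIM X) :
    conj (e.trans e') α = conj e' (conj e α) := by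
  refine ext_mem fun x z => ?_
  simp only [mem_conj, Equiv.symm_trans_apply]

theorem conj_symm_eq_iff {e : X ≃ Y} {α : SIM X} {β : SIM Y} :
    conj e.symm β = α ↔ conj e α = β := by
  constructor
  · rintro rfl
    exact ext_mem fun x z => by
      simp only [mem_conj, Equiv.symm_symm, Equiv.apply_symm_apply]
  · rintro rfl
    exact ext_mem fun x z => by
      simp only [mem_conj, Equiv.symm_symm, Equiv.symm_apply_apply]

/-- A chart of `α`: `f` identifies `X` with the disjoint union of paths with `h s` digits, one for
each `s : S`, on which `α` moves every digit to the next one. -/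
structure IsChart {S : Type*} (α : SIM X) (h : S → ℕ) (f : X → S × ℕ) : Prop where
  injective : Function.Injective f
  exists_iff : ∀ s i, (∃ x, f x = (s, i)) ↔ i < h s
  mem_iff : ∀ x y, y ∈ α x ↔ f y = ((f x).1, (f x).2 + 1)

namespace IsChart

variable {S T : Type*} {α : SIM X} {h : S → ℕ} {f : X → S × ℕ} {h' : T → ℕ} {f' : X → T × ℕ}

theorem lt (hf : IsChart α h f) (x : X) : (f x).2 < h (f x).1 :=
  (hf.exists_iff _ _).1 ⟨x, rfl⟩

theorem exists_eq (hf : IsChart α h f) {s : S} {i : ℕ} (hi : i < h s) : ∃ x, f x = (s, i) :=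
  (hf.exists_iff s i).2 hi

theorem mem_pow_iff (hf : IsChart α h f) (k : ℕ) (x y : X) :
    y ∈ (α ^ k) x ↔ f y = ((f x).1, (f x).2 + k) := by
  induction k generalizing y with
  | zero =>
    rw [pow_zero, mem_one]
    exact ⟨fun h => h ▸ rfl, fun h => hf.injective h.symm⟩
  | succ k ih =>
    rw [pow_succ', mem_mul]
    constructor
    · rintro ⟨z, hz, hy⟩
      rw [ih] at hz
      rw [hf.mem_iff, hz] at hy
      exact hy
    · intro hy
      have h1 := hf.lt y
      rw [hy] at h1
      obtain ⟨z, hz⟩ := hf.exists_eq (s := (f x).1) (i := (f x).2 + k) (by dsimp at h1; omega)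
      refine ⟨z, (ih z).2 hz, ?_⟩
      rw [hf.mem_iff, hz, hy]
      rfl

theorem exists_mem_pow_iff (hf : IsChart α h f) (k : ℕ) (x : X) :
    (∃ y, y ∈ (α ^ k) x) ↔ (f x).2 + k < h (f x).1 := by
  simp only [hf.mem_pow_iff]
  exact hf.exists_iff _ _

theorem exists_mem_iff (hf : IsChart α h f) (x : X) : (∃ w, x ∈ α w) ↔ 0 < (f x).2 := by
  constructor
  · rintro ⟨w, hw⟩
    rw [hf.mem_iff] at hw
    simp [hw]
  · intro h0
    have h1 := hf.lt x
    obtain ⟨w, hw⟩ := hf.exists_eq (s := (f x).1) (i := (f x).2 - 1) (by omega)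
    refine ⟨w, (hf.mem_iff _ _).2 ?_⟩
    rw [hw]
    exact Prod.ext rfl (by dsimp; omega)

theorem pow (hf : IsChart α h f) {k : ℕ} (hk : 0 < k) :
    IsChart (α ^ k) (fun q : S × Fin k => (h q.1 + k - 1 - q.2) / k)
      (fun x => (((f x).1, ⟨(f x).2 % k, Nat.mod_lt _ hk⟩), (f x).2 / k)) where
  injective x y hxy := by
    simp only [Prod.mk.injEq, Fin.mk.injEq] at hxy
    obtain ⟨⟨h1, h2⟩, h3⟩ := hxy
    refine hf.injective (Prod.ext h1 ?_)
    rw [← Nat.div_add_mod (f x).2 k, ← Nat.div_add_mod (f y).2 k, h2, h3]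
  exists_iff := by
    rintro ⟨s, r⟩ q
    have hr := r.2
    have key : q < (h s + k - 1 - r) / k ↔ q * k + r < h s := by
      rw [← Nat.succ_le_iff, Nat.le_div_iff_mul_le hk, Nat.succ_mul]
      omega
    dsimp only
    rw [key, ← hf.exists_iff]
    refine exists_congr fun x => ?_
    simp only [Prod.ext_iff, Fin.ext_iff]
    constructor
    · rintro ⟨⟨h1, h2⟩, h3⟩
      refine ⟨h1, ?_⟩
      rw [← Nat.div_add_mod (f x).2 k, h2, h3, mul_comm]
    · rintro ⟨h1, h2⟩
      rw [h2, mul_comm]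
      refine ⟨⟨h1, ?_⟩, ?_⟩
      · simp [Nat.mod_eq_of_lt hr]
      · simp [Nat.mul_add_div hk, Nat.div_eq_of_lt hr]
  mem_iff x y := by
    rw [hf.mem_pow_iff]
    simp only [Prod.ext_iff, Fin.ext_iff]
    constructor
    · rintro ⟨h1, h2⟩
      rw [h2]
      exact ⟨⟨h1, Nat.add_mod_right _ _⟩, Nat.add_div_right _ hk⟩
    · rintro ⟨⟨h1, h2⟩, h3⟩
      refine ⟨h1, ?_⟩
      rw [← Nat.div_add_mod (f x).2 k, ← Nat.div_add_mod (f y).2 k, h2, h3]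
      ring

theorem exists_comparison (hf : IsChart α h f) (hf' : IsChart α h' f') (hpos : ∀ s, 0 < h s) :
    ∃ G : S → T, ∀ x, f' x = (G (f x).1, (f x).2) := by
  have h1 : ∀ s, ∃ x, f x = (s, 0) := fun s => hf.exists_eq (hpos s)
  choose b hb using h1
  refine ⟨fun s => (f' (b s)).1, fun x => ?_⟩
  have h2 : x ∈ (α ^ (f x).2) (b (f x).1) := by
    rw [hf.mem_pow_iff, hb]
    simp
  have h3 : (f' (b (f x).1)).2 = 0 := by
    by_contra h4
    have h5 := (hf'.exists_mem_iff _).2 (Nat.pos_of_ne_zero h4)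
    rw [hf.exists_mem_iff, hb] at h5
    simp at h5
  rw [hf'.mem_pow_iff, h3, zero_add] at h2
  exact h2

theorem exists_equiv (hf : IsChart α h f) (hf' : IsChart α h' f') (hpos : ∀ s, 0 < h s)
    (hpos' : ∀ t, 0 < h' t) :
    ∃ G : S ≃ T, (∀ s, h' (G s) = h s) ∧ ∀ x, f' x = (G (f x).1, (f x).2) := by
  obtain ⟨G, hG⟩ := hf.exists_comparison hf' hpos
  obtain ⟨H, hH⟩ := hf'.exists_comparison hf hpos'
  have hHG : Function.LeftInverse H G := fun s => by
    obtain ⟨x, hx⟩ := hf.exists_eq (hpos s)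
    have := hH x
    rw [hG, hx] at this
    exact (congrArg Prod.fst this).symm
  have hGH : Function.RightInverse H G := fun t => by
    obtain ⟨x, hx⟩ := hf'.exists_eq (hpos' t)
    have := hG x
    rw [hH, hx] at this
    exact (congrArg Prod.fst this).symm
  refine ⟨⟨G, H, hHG, hGH⟩, fun s => eq_of_forall_lt_iff fun i => ?_, hG⟩
  dsimp only [Equiv.coe_fn_mk]
  rw [← hf.exists_iff, ← hf'.exists_iff]
  refine exists_congr fun x => ?_
  rw [hG x, Prod.ext_iff, Prod.ext_iff]
  exact and_congr_left fun _ => hHG.injective.eq_iff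

theorem exists_lift {β : SIM Y} {g : Y → T × ℕ} (hf : IsChart α h f) (hg : IsChart β h' g)
    (e₀ : S ≃ T) (he₀ : ∀ s, h' (e₀ s) = h s) :
    ∃ e : X ≃ Y, conj e α = β ∧ ∀ x, g (e x) = (e₀ (f x).1, (f x).2) := by
  have h1 : ∀ x, ∃ y, g y = (e₀ (f x).1, (f x).2) := fun x =>
    hg.exists_eq (by rw [he₀]; exact hf.lt x)
  have h2 : ∀ y, ∃ x, f x = (e₀.symm (g y).1, (g y).2) := fun y =>
    hf.exists_eq (by rw [← he₀, e₀.apply_symm_apply]; exact hg.lt y)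
  choose a ha using h1
  choose b hb using h2
  refine ⟨⟨a, b, fun x => hf.injective ?_, fun y => hg.injective ?_⟩, ?_, ha⟩
  · rw [hb, ha]; simp
  · rw [ha, hb]; simp
  · rw [conj_eq_iff]
    intro x y
    simp only [Equiv.coe_fn_mk]
    rw [hg.mem_iff, hf.mem_iff, ha, ha]
    simp [Prod.ext_iff]

theorem comp_equiv {β : SIM Y} {e : Y ≃ X} (hf : IsChart α h f) (he : conj e β = α) :
    IsChart β h (f ∘ e) where
  injective := hf.injective.comp e.injective
  exists_iff s i := by
    rw [← hf.exists_iff]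
    exact e.surjective.exists (p := fun x => f x = (s, i)) |>.symm
  mem_iff x y := by
    rw [← conj_eq_iff.1 he, hf.mem_iff]
    rfl

/-- The automorphisms of a disjoint union of paths permute paths of equal length. -/
theorem card_centralizer (hf : IsChart α h f) (hpos : ∀ s, 0 < h s) :
    Nat.card {e : X ≃ X // conj e α = α} = Nat.card {g : Equiv.Perm S // h ∘ g = h} := by
  have h1 : ∀ g : {g : Equiv.Perm S // h ∘ g = h}, ∃ e : X ≃ X, conj e α = α ∧
      ∀ x, f (e x) = (g.1 (f x).1, (f x).2) := fun g =>
    hf.exists_lift hf g.1 (congrFun g.2)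
  choose E hE1 hE2 using h1
  refine (Nat.card_congr (Equiv.ofBijective (fun g => (⟨E g, hE1 g⟩ :
    {e : X ≃ X // conj e α = α})) ⟨fun g g' hgg => ?_, ?_⟩)).symm
  · refine Subtype.ext (Equiv.ext fun s => ?_)
    obtain ⟨x, hx⟩ := hf.exists_eq (hpos s)
    have h2 := hE2 g x
    rw [show E g = E g' from congrArg Subtype.val hgg, hE2, hx] at h2
    exact (congrArg Prod.fst h2).symm
  · rintro ⟨e, he⟩
    obtain ⟨G, hG1, hG2⟩ := hf.exists_equiv (hf.comp_equiv he) hpos hpos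
    refine ⟨⟨G, funext hG1⟩, Subtype.ext (Equiv.ext fun x => hf.injective ?_)⟩
    exact (hE2 _ x).trans (hG2 x).symm

end IsChart

/-- The number of paths of `α` with `j + 1` digits. -/
noncomputable def pathCount (α : SIM X) (j : ℕ) : ℕ :=
  Nat.card {x // (¬ ∃ w, x ∈ α w) ∧ (∃ y, y ∈ (α ^ j) x) ∧ ¬ ∃ y, y ∈ (α ^ (j + 1)) x}

namespace IsChart

variable {S T : Type*} {α : SIM X} {h : S → ℕ} {f : X → S × ℕ}

theorem pathCount_eq (hf : IsChart α h f) (j : ℕ) :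
    pathCount α j = Nat.card {s // h s = j + 1} := by
  have h1 : ∀ s : {s // h s = j + 1}, ∃ x, f x = (s.1, 0) := fun s =>
    hf.exists_eq (by rw [s.2]; omega)
  choose b hb using h1
  unfold pathCount
  simp only [hf.exists_mem_iff, hf.exists_mem_pow_iff]
  refine (Nat.card_congr (Equiv.ofBijective (fun s => (⟨b s, ?_⟩ :
    {x // ¬ 0 < (f x).2 ∧ (f x).2 + j < h (f x).1 ∧ ¬ (f x).2 + (j + 1) < h (f x).1}))
    ⟨fun s t hst => ?_, ?_⟩)).symm
  · rw [hb]
    have := s.2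
    dsimp
    omega
  · have h2 := hb s
    rw [show b s = b t from congrArg Subtype.val hst, hb] at h2
    exact Subtype.ext (congrArg Prod.fst h2).symm
  · rintro ⟨x, hx1, hx2, hx3⟩
    refine ⟨⟨(f x).1, by omega⟩, Subtype.ext (hf.injective ?_)⟩
    dsimp only
    rw [hb]
    exact Prod.ext rfl (by dsimp; omega)

theorem exists_conj_eq [Finite S] [Finite T] {β : SIM Y} {h' : T → ℕ} {g : Y → T × ℕ}
    (hf : IsChart α h f) (hg : IsChart β h' g) (hpos : ∀ s, 0 < h s) (hpos' : ∀ t, 0 < h' t)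
    (hc : ∀ j, pathCount α j = pathCount β j) : ∃ e : X ≃ Y, conj e α = β := by
  have h1 : ∀ j, Nonempty ({s // h s = j} ≃ {t // h' t = j}) := by
    rintro (_ | j)
    · have : IsEmpty {s // h s = 0} := ⟨fun s => (hpos s.1).ne' s.2⟩
      have : IsEmpty {s // h' s = 0} := ⟨fun s => (hpos' s.1).ne' s.2⟩
      exact ⟨Equiv.equivOfIsEmpty _ _⟩
    · have := hc j
      rw [hf.pathCount_eq, hg.pathCount_eq] at this
      exact Finite.card_eq.1 this
  obtain ⟨e, he, -⟩ := hf.exists_lift hg (Equiv.ofFiberEquiv fun j => (h1 j).some)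
    fun s => Equiv.ofFiberEquiv_map _ s
  exact ⟨e, he⟩

end IsChart

/-- A nilpotent partial one-to-one map is a disjoint union of paths. -/
theorem exists_isChart {α : SIM X} {N : ℕ} (hN : ∀ x y, y ∉ (α ^ N) x) :
    ∃ (h : {x // ¬ ∃ w, x ∈ α w} → ℕ) (f : X → {x // ¬ ∃ w, x ∈ α w} × ℕ),
      IsChart α h f ∧ ∀ s, 0 < h s := by
  classical
  have hadd : ∀ (a b : ℕ) (x z : X),
      z ∈ (α ^ (a + b)) x ↔ ∃ y, y ∈ (α ^ a) x ∧ z ∈ (α ^ b) y := fun a b x z => by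
    rw [add_comm, pow_add, mem_mul]
  have hex : ∀ s : {x // ¬ ∃ w, x ∈ α w}, ∃ j, ¬ ∃ y, y ∈ (α ^ j) s.1 :=
    fun s => ⟨N, fun ⟨y, hy⟩ => hN _ _ hy⟩
  have hpre : ∀ x : X, ∃ q : {x // ¬ ∃ w, x ∈ α w} × ℕ, x ∈ (α ^ q.2) q.1.1 := by
    by_contra! hcon
    obtain ⟨x, hx⟩ := hcon
    have h1 : ∀ j, ∃ w, x ∈ (α ^ j) w := by
      intro j
      induction j with
      | zero => exact ⟨x, mem_one.2 rfl⟩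
      | succ j ih =>
        obtain ⟨w, hw⟩ := ih
        by_cases h2 : ∃ v, w ∈ α v
        · obtain ⟨v, hv⟩ := h2
          refine ⟨v, ?_⟩
          rw [add_comm, hadd]
          exact ⟨w, by rwa [pow_one], hw⟩
        · exact absurd hw (hx (⟨w, h2⟩, j))
    obtain ⟨w, hw⟩ := h1 N
    exact hN _ _ hw
  choose f hfm using hpre
  have huniq : ∀ (s t : {x // ¬ ∃ w, x ∈ α w}) (i j : ℕ) (x : X), i ≤ j →
      x ∈ (α ^ i) s.1 → x ∈ (α ^ j) t.1 → s = t ∧ i = j := by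
    intro s t i j x hij hs ht
    obtain ⟨d, rfl⟩ := Nat.exists_eq_add_of_le hij
    rw [add_comm, hadd] at ht
    obtain ⟨y, hy, hyx⟩ := ht
    obtain rfl := PEquiv.inj _ hyx hs
    cases d with
    | zero => exact ⟨Subtype.ext (mem_one.1 hy).symm, rfl⟩
    | succ d =>
      rw [hadd] at hy
      obtain ⟨z, -, hz⟩ := hy
      rw [pow_one] at hz
      exact absurd ⟨z, hz⟩ s.2
  have hf : ∀ (x : X) (s : {x // ¬ ∃ w, x ∈ α w}) (i : ℕ), x ∈ (α ^ i) s.1 ↔ f x = (s, i) := by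
    intro x s i
    constructor
    · intro h1
      rcases le_total (f x).2 i with h2 | h2
      · exact Prod.ext_iff.2 (huniq _ _ _ _ x h2 (hfm x) h1)
      · exact (Prod.ext_iff.2 (huniq _ _ _ _ x h2 h1 (hfm x))).symm
    · intro h1
      have := hfm x
      rwa [h1] at this
  refine ⟨fun s => Nat.find (hex s), f, ⟨fun x y hxy => ?_, fun s i => ?_, fun x y => ?_⟩,
    fun s => ?_⟩
  · have h1 := hfm x
    rw [hxy] at h1
    exact Option.mem_unique h1 (hfm y)
  · rw [Nat.lt_find_iff]
    simp only [← hf, not_not]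
    constructor
    · rintro ⟨x, hx⟩ l hl
      obtain ⟨d, rfl⟩ := Nat.exists_eq_add_of_le hl
      obtain ⟨y, hy, -⟩ := (hadd _ _ _ _).1 hx
      exact ⟨y, hy⟩
    · exact fun h1 => h1 i le_rfl
  · rw [← hf, hadd]
    constructor
    · intro hy
      exact ⟨x, hfm x, by rwa [pow_one]⟩
    · rintro ⟨z, hz, hy⟩
      obtain rfl := Option.mem_unique hz (hfm x)
      rwa [pow_one] at hy
  · rw [Nat.find_pos]
    exact fun h1 => h1 ⟨s.1, mem_one.2 rfl⟩

/-- Every family of lengths is realized by a disjoint union of paths. -/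
theorem exists_model {S : Type*} (h : S → ℕ) :
    ∃ β : SIM (Σ s, Fin (h s)), IsChart β h fun x => (x.1, x.2.val) := by
  classical
  refine ⟨{
    toFun := fun x => if hx : x.2.val + 1 < h x.1 then some ⟨x.1, ⟨x.2.val + 1, hx⟩⟩ else none
    invFun := fun y => if 0 < y.2.val then
      some ⟨y.1, ⟨y.2.val - 1, lt_of_le_of_lt (Nat.sub_le _ _) y.2.2⟩⟩ else none
    inv := ?_ }, fun x y hxy => ?_, fun s i => ?_, ?_⟩
  · rintro ⟨s, i, hi⟩ ⟨t, j, hj⟩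
    dsimp only
    split_ifs with h1 h2 h2
    · simp only [Option.some.injEq, Sigma.mk.injEq]
      constructor
      · rintro ⟨rfl, h3⟩
        simp only [heq_eq_eq, Fin.mk.injEq] at h3 ⊢
        exact ⟨trivial, by omega⟩
      · rintro ⟨rfl, h3⟩
        simp only [heq_eq_eq, Fin.mk.injEq] at h3 ⊢
        exact ⟨trivial, by omega⟩
    · simp only [Option.some.injEq, Sigma.mk.injEq, iff_false]
      rintro ⟨rfl, h3⟩
      simp only [heq_eq_eq, Fin.mk.injEq] at h3
      omega
    · simp only [Option.some.injEq, Sigma.mk.injEq, false_iff]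
      rintro ⟨rfl, h3⟩
      simp only [heq_eq_eq, Fin.mk.injEq] at h3
      omega
    · simp
  · obtain ⟨s, i⟩ := x
    obtain ⟨t, j⟩ := y
    simp only [Prod.mk.injEq] at hxy
    obtain ⟨rfl, h2⟩ := hxy
    rw [Fin.ext h2]
  · constructor
    · rintro ⟨x, hx⟩
      obtain ⟨rfl, rfl⟩ := Prod.ext_iff.1 hx
      exact x.2.2
    · exact fun hi => ⟨⟨s, i, hi⟩, rfl⟩
  · rintro ⟨s, i, hi⟩ ⟨t, j, hj⟩
    change _ ∈ (if hx : i + 1 < h s then some (⟨s, ⟨i + 1, hx⟩⟩ : Σ s, Fin (h s)) else none) ↔ _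
    split_ifs with h1
    · simp only [Option.mem_def, Option.some.injEq, Sigma.mk.injEq, Prod.mk.injEq]
      constructor
      · rintro ⟨rfl, h3⟩
        simp only [heq_eq_eq, Fin.mk.injEq] at h3 ⊢
        exact ⟨trivial, h3.symm⟩
      · rintro ⟨rfl, h3⟩
        simp only [heq_eq_eq, Fin.mk.injEq] at h3 ⊢
        exact ⟨trivial, h3.symm⟩
    · simp only [Option.mem_def, reduceCtorEq, Prod.mk.injEq, false_iff]
      rintro ⟨rfl, rfl⟩
      exact h1 hj

/-- Counting the isomorphisms from `β ^ k` to `σ` in two ways. -/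
theorem card_conj_roots_mul [Finite X] {β : SIM Y} {σ : SIM X} {k : ℕ} {e₀ : Y ≃ X}
    (he₀ : conj e₀ (β ^ k) = σ) :
    Nat.card {α : SIM X // α ^ k = σ ∧ ∃ e : Y ≃ X, conj e β = α} *
      Nat.card {e : Y ≃ Y // conj e β = β} = Nat.card {e : X ≃ X // conj e σ = σ} := by
  have hfinY : Finite Y := Finite.of_equiv X e₀.symm
  have h1 : ∀ a : {α : SIM X // α ^ k = σ ∧ ∃ e : Y ≃ X, conj e β = α},
      ∃ e : Y ≃ X, conj e β = a.1 := fun a => a.2.2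
  choose E hE using h1
  rw [← Nat.card_prod]
  refine Nat.card_congr (Equiv.ofBijective (fun q => (⟨e₀.symm.trans (q.2.1.trans (E q.1)), ?_⟩ :
    {e : X ≃ X // conj e σ = σ})) ⟨?_, ?_⟩)
  · rw [conj_trans, conj_trans, conj_symm_eq_iff.2 he₀, conj_pow, q.2.2, conj_pow, hE, q.1.2.1]
  · rintro ⟨a, u, hu⟩ ⟨b, v, hv⟩ huv
    have h2 : u.trans (E a) = v.trans (E b) := by
      refine Equiv.ext fun y => ?_
      have := Equiv.congr_fun (congrArg Subtype.val huv) (e₀ y)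
      simpa using this
    have h3 : a = b := by
      refine Subtype.ext ?_
      have := congrArg (conj · β) h2
      simpa only [conj_trans, hu, hv, hE] using this
    subst h3
    have h4 : u = v := by
      refine Equiv.ext fun y => (E a).injective ?_
      exact Equiv.congr_fun h2 y
    subst h4
    rfl
  · rintro ⟨w, hw⟩
    have h2 : conj (e₀.trans w) β ^ k = σ := by
      rw [← conj_pow, conj_trans, he₀, hw]
    let a : {α : SIM X // α ^ k = σ ∧ ∃ e : Y ≃ X, conj e β = α} :=
      ⟨conj (e₀.trans w) β, h2, e₀.trans w, rfl⟩
    refine ⟨⟨a, (e₀.trans w).trans (E a).symm, ?_⟩, Subtype.ext (Equiv.ext fun x => ?_)⟩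
    · rw [conj_trans, conj_symm_eq_iff, hE]
    · simp

end SIM

/-- The length of a path of a root whose longest section has `m - i` digits, where `a + 1` sections
have this length. -/
def rootLength {m k : ℕ} (c : Fin m × Fin k) : ℕ := c.1.rev * k + c.2 + 1

/-- The number of paths with `m - j` digits into which the `k`th power of a path of length
`rootLength c` splits. -/
def splitCount {m k : ℕ} (j : Fin m) (c : Fin m × Fin k) : ℕ :=
  (if c.1 = j then c.2.val + 1 else 0) + (if c.1.val + 1 = j.val then k - 1 - c.2 else 0)

theorem rootLength_div {m k : ℕ} (c : Fin m × Fin k) (r : Fin k) :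
    (rootLength c + k - 1 - r) / k = c.1.rev + if r ≤ c.2 then 1 else 0 := by
  obtain ⟨i, a⟩ := c
  have ha := a.2
  have hr := r.2
  have hk : 0 < k := by omega
  unfold rootLength
  dsimp only
  split_ifs with h
  · have h' : r.val ≤ a.val := h
    have : i.rev.val * k + a.val + 1 + k - 1 - r.val = k * (i.rev.val + 1) + (a - r) := by
      rw [mul_add, mul_comm]; omega
    rw [this, Nat.mul_add_div hk, Nat.div_eq_of_lt (by omega)]
  · have h' : a.val < r.val := not_le.1 h
    have : i.rev.val * k + a.val + 1 + k - 1 - r.val = k * i.rev.val + (a + k - r) := by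
      rw [mul_comm]; omega
    rw [this, Nat.mul_add_div hk, Nat.div_eq_of_lt (by omega)]

theorem card_rootLength_div {m k : ℕ} (j : Fin m) (c : Fin m × Fin k) :
    (∑ r : Fin k, if (rootLength c + k - 1 - r) / k = j.rev.val + 1 then 1 else 0) =
      splitCount j c := by
  simp only [rootLength_div]
  obtain ⟨i, a⟩ := c
  unfold splitCount
  have hi := i.2
  have hj := j.2
  have hrev : ∀ i : Fin m, i.rev.val = m - (i.val + 1) := fun i => Fin.val_rev i
  dsimp only
  rw [hrev, hrev, Finset.sum_boole, Nat.cast_id]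
  by_cases h1 : i = j
  · subst h1
    have : (Finset.univ.filter fun r : Fin k =>
        m - (i.val + 1) + (if r ≤ a then 1 else 0) = m - (i.val + 1) + 1) = Finset.Iic a := by
      ext r
      by_cases h : r ≤ a <;> simp [h]
    rw [this, Fin.card_Iic]
    simp
  · have h1' : i.val ≠ j.val := fun h => h1 (Fin.ext h)
    by_cases h2 : i.val + 1 = j.val
    · have : (Finset.univ.filter fun r : Fin k =>
          m - (i.val + 1) + (if r ≤ a then 1 else 0) = m - (j.val + 1) + 1) = Finset.Ioi a := by
        ext r
        by_cases h : r ≤ a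
        · simp [h]; omega
        · simp [h, not_le.1 h]; omega
      rw [this, Fin.card_Ioi, if_neg h1, if_pos h2, zero_add]
    · rw [if_neg h1, if_neg h2, Finset.card_eq_zero, Finset.filter_eq_empty_iff]
      intro r _
      split_ifs <;> omega

theorem rootLength_injective {m k : ℕ} : Function.Injective (@rootLength m k) := by
  rintro ⟨i, a⟩ ⟨j, b⟩ h
  have hi := i.2
  have hj := j.2
  have ha := a.2
  have hb := b.2
  have hk : 0 < k := by omega
  unfold rootLength at h
  dsimp only at h
  have hq : ∀ (q : ℕ) (a : Fin k), (q * k + a) / k = q ∧ (q * k + a) % k = a := fun q a => by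
    rw [mul_comm]
    exact ⟨by rw [Nat.mul_add_div hk, Nat.div_eq_of_lt a.2, add_zero],
      by rw [Nat.mul_add_mod, Nat.mod_eq_of_lt a.2]⟩
  have h' : i.rev.val * k + a = j.rev.val * k + b := by omega
  have h1 : i.rev.val = j.rev.val := by rw [← (hq i.rev a).1, h', (hq j.rev b).1]
  have h2 : a.val = b.val := by rw [← (hq i.rev a).2, h', (hq j.rev b).2]
  exact Prod.ext (Fin.rev_injective (Fin.ext h1)) (Fin.ext h2)

theorem exists_rootLength_eq {m k L : ℕ} (hk : 0 < k) (h0 : 0 < L) (hL : L ≤ m * k) :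
    ∃ c : Fin m × Fin k, rootLength c = L := by
  have h1 : (L - 1) / k < m := (Nat.div_lt_iff_lt_mul hk).2 (by omega)
  refine ⟨(Fin.rev ⟨(L - 1) / k, h1⟩, ⟨(L - 1) % k, Nat.mod_lt _ hk⟩), ?_⟩
  unfold rootLength
  rw [Fin.rev_rev]
  dsimp only
  rw [mul_comm, Nat.div_add_mod]
  omega

namespace SIM

variable {X Y S T : Type*}

theorem IsChart.notMem_pow {α : SIM X} {h : S → ℕ} {f : X → S × ℕ} (hf : IsChart α h f) {N : ℕ}
    (hN : ∀ s, h s ≤ N) (x y : X) : y ∉ (α ^ N) x := fun hy => by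
  have h1 := (hf.exists_mem_pow_iff N x).1 ⟨y, hy⟩
  have h2 := hN (f x).1
  omega

theorem exists_conj_eq_of_pathCount_eq [Finite X] [Finite Y] {α : SIM X} {β : SIM Y} {N : ℕ}
    (hα : ∀ x y, y ∉ (α ^ N) x) (hβ : ∀ x y, y ∉ (β ^ N) x)
    (hc : ∀ j, pathCount α j = pathCount β j) : ∃ e : X ≃ Y, conj e α = β := by
  obtain ⟨h, f, hf, hpos⟩ := exists_isChart hα
  obtain ⟨h', g, hg, hpos'⟩ := exists_isChart hβ
  exact hf.exists_conj_eq hg hpos hpos' hc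

theorem IsChart.pathCount_pow [Finite S] {m k : ℕ} (hk : 0 < k) {α : SIM X}
    {c : S → Fin m × Fin k} {f : X → S × ℕ} (hf : IsChart α (fun s => rootLength (c s)) f)
    (j : Fin m) :
    pathCount (α ^ k) j.rev = ∑ b, Nat.card {s // c s = b} * splitCount j b := by
  classical
  cases nonempty_fintype S
  rw [(hf.pow hk).pathCount_eq, Nat.card_eq_fintype_card, Fintype.card_subtype,
    Finset.card_filter, Fintype.sum_prod_type]
  simp only [card_rootLength_div]
  rw [← Fintype.sum_fiberwise' c (splitCount j)]
  refine Finset.sum_congr rfl fun b _ => ?_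
  rw [Finset.sum_const, Finset.card_univ, smul_eq_mul, Nat.card_eq_fintype_card]

end SIM

/-! ### Chains of partitions and their frequencies -/

theorem IntPartition.ext_parts {l l' : IntPartition} (h : l.2.parts = l'.2.parts) : l = l' := by
  obtain ⟨s, l⟩ := l
  obtain ⟨s', l'⟩ := l'
  have h1 : s = s' := by
    rw [← l.parts_sum, ← l'.parts_sum]
    exact congrArg _ h
  subst h1
  exact congrArg _ (Nat.Partition.ext h)

/-- The frequencies of the parts `1, …, k` in a chain of partitions. -/
def chainFreq {m : ℕ} (k : ℕ) (lam : Fin m → IntPartition) (c : Fin m × Fin k) : ℕ :=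
  IntPartition.freq (c.2 + 1) (lam c.1)

/-- The chain of partitions with given frequencies. -/
def chainOfFreq {m k : ℕ} (d : Fin m × Fin k → ℕ) (i : Fin m) : IntPartition :=
  ⟨_, ⟨∑ a : Fin k, Multiset.replicate (d (i, a)) (a.val + 1), fun {b} hb => by
    obtain ⟨a, -, ha⟩ := Multiset.mem_sum.1 hb
    rw [Multiset.eq_of_mem_replicate ha]
    omega, rfl⟩⟩

theorem le_of_mem_chainOfFreq {m k : ℕ} (d : Fin m × Fin k → ℕ) (i : Fin m) {b : ℕ}
    (hb : b ∈ (chainOfFreq d i).2.parts) : b ≤ k := by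
  change b ∈ ∑ a : Fin k, Multiset.replicate (d (i, a)) (a.val + 1) at hb
  obtain ⟨a, -, ha⟩ := Multiset.mem_sum.1 hb
  rw [Multiset.eq_of_mem_replicate ha]
  omega

theorem chainFreq_chainOfFreq {m k : ℕ} (d : Fin m × Fin k → ℕ) :
    chainFreq k (chainOfFreq d) = d := by
  funext ⟨i, a⟩
  change Multiset.count (a.val + 1) (∑ a : Fin k, Multiset.replicate (d (i, a)) (a.val + 1)) = _
  rw [Multiset.count_sum']
  simp only [Multiset.count_replicate, add_left_inj, Fin.val_inj]
  simp

theorem eq_of_chainFreq_eq {m k : ℕ} {lam lam' : Fin m → IntPartition}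
    (h : ∀ i, ∀ a ∈ (lam i).2.parts, a ≤ k) (h' : ∀ i, ∀ a ∈ (lam' i).2.parts, a ≤ k)
    (hf : chainFreq k lam = chainFreq k lam') : lam = lam' := by
  funext i
  refine IntPartition.ext_parts (Multiset.ext.2 fun b => ?_)
  by_cases hb : 0 < b ∧ b ≤ k
  · have := congrFun hf (i, ⟨b - 1, by omega⟩)
    unfold chainFreq IntPartition.freq at this
    dsimp only at this
    rwa [Nat.sub_add_cancel hb.1] at this
  · rw [Multiset.count_eq_zero_of_notMem, Multiset.count_eq_zero_of_notMem]
    · exact fun h1 => hb ⟨(lam' i).2.parts_pos h1, h' i b h1⟩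
    · exact fun h1 => hb ⟨(lam i).2.parts_pos h1, h i b h1⟩

@[to_additive]
theorem Multiset.prod_toFinset_eq_prod_fin {M : Type*} [CommMonoid M] {k : ℕ} {s : Multiset ℕ}
    (h0 : ∀ b ∈ s, 0 < b) (hk : ∀ b ∈ s, b ≤ k) (F : ℕ → M) (hF : ∀ b, b ∉ s → F b = 1) :
    ∏ b ∈ s.toFinset, F b = ∏ a : Fin k, F (a + 1) := by
  rw [← Finset.prod_image (s := Finset.univ) (g := fun a : Fin k => a.val + 1) (f := F)
    (fun a _ b _ hab => Fin.ext (Nat.succ_injective hab))]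
  refine Finset.prod_subset (fun b hb => ?_) fun b _ hb => hF b (by simpa using hb)
  rw [Multiset.mem_toFinset] at hb
  have h1 := h0 b hb
  have h2 := hk b hb
  exact Finset.mem_image.2 ⟨⟨b - 1, by omega⟩, Finset.mem_univ _, Nat.sub_add_cancel h1⟩

section Frequencies

variable {m k : ℕ} {lam : Fin m → IntPartition} (hmax : ∀ i, ∀ a ∈ (lam i).2.parts, a ≤ k)
include hmax

theorem freqFactorialProd_eq (i : Fin m) :
    IntPartition.freqFactorialProd (lam i) = ∏ a : Fin k, (chainFreq k lam (i, a)).factorial :=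
  Multiset.prod_toFinset_eq_prod_fin (fun _ hb => (lam i).2.parts_pos hb) (hmax i)
    (fun b => ((lam i).2.parts.count b).factorial)
    fun b hb => by rw [Multiset.count_eq_zero_of_notMem hb, Nat.factorial_zero]

theorem sum_eq_sum_chainFreq (i : Fin m) :
    (lam i).1 = ∑ a : Fin k, chainFreq k lam (i, a) * (a + 1) := by
  refine Eq.trans ?_ (Multiset.sum_toFinset_eq_sum_fin (fun _ hb => (lam i).2.parts_pos hb)
    (hmax i) (fun b => (lam i).2.parts.count b * b)
    fun b hb => by rw [Multiset.count_eq_zero_of_notMem hb, zero_mul])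
  conv_lhs => rw [← (lam i).2.parts_sum, Finset.sum_multiset_count]
  rfl

theorem length_eq_sum_chainFreq (i : Fin m) :
    IntPartition.length (lam i) = ∑ a : Fin k, chainFreq k lam (i, a) := by
  refine Eq.trans ?_ (Multiset.sum_toFinset_eq_sum_fin (fun _ hb => (lam i).2.parts_pos hb)
    (hmax i) (fun b => (lam i).2.parts.count b)
    fun b hb => Multiset.count_eq_zero_of_notMem hb)
  exact (Multiset.toFinset_sum_count_eq _).symm

theorem sum_splitCount_of_zero {j : Fin m} (hj : j.val = 0) :
    ∑ c, chainFreq k lam c * splitCount j c = (lam j).1 := by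
  rw [sum_eq_sum_chainFreq hmax, Fintype.sum_prod_type, Finset.sum_eq_single j]
  · exact Finset.sum_congr rfl fun a _ => by simp [splitCount]
  · intro i _ hij
    exact Finset.sum_eq_zero fun a _ => by simp [splitCount, hij, hj]
  · simp

theorem sum_splitCount_of_succ {i j : Fin m} (hij : j.val = i.val + 1) :
    ∑ c, chainFreq k lam c * splitCount j c + (lam i).1 =
      (lam j).1 + k * IntPartition.length (lam i) := by
  have h1 : ∀ i', i'.val + 1 = j.val ↔ i' = i := fun i' => by rw [Fin.ext_iff]; omega
  simp only [splitCount, mul_add, Finset.sum_add_distrib]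
  rw [add_assoc]
  congr 1
  · rw [sum_eq_sum_chainFreq hmax, Fintype.sum_prod_type, Finset.sum_eq_single j]
    · simp
    · intro i' _ h
      simp [h]
    · simp
  · rw [sum_eq_sum_chainFreq hmax, length_eq_sum_chainFreq hmax, Fintype.sum_prod_type,
      Finset.sum_eq_single i, ← Finset.sum_add_distrib, Finset.mul_sum]
    · refine Finset.sum_congr rfl fun a _ => ?_
      have ha := a.2
      rw [if_pos hij.symm, ← mul_add, mul_comm]
      congr 1
      dsimp only
      omega
    · intro i' _ h
      simp [h1, h]
    · simp

/-- A chain is admissible if and only if the `k`th power of a partial map with these path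
frequencies has `n j` paths with `m - j` digits. -/
theorem isAdmissibleChain_iff (n : Fin m → ℕ) :
    IsAdmissibleChain k n lam ↔ ∀ j, ∑ c, chainFreq k lam c * splitCount j c = n j := by
  have hIic : ∀ {i j : Fin m}, j.val = i.val + 1 → Finset.Iic j = insert j (Finset.Iic i) := by
    intro i j hij
    ext l
    simp only [Finset.mem_Iic, Finset.mem_insert, Fin.le_def, Fin.ext_iff]
    omega
  have hIio : ∀ {i j : Fin m}, j.val = i.val + 1 → Finset.Iio j = insert i (Finset.Iio i) := by
    intro i j hij
    ext l
    simp only [Finset.mem_Iio, Finset.mem_insert, Fin.lt_def, Fin.ext_iff]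
    omega
  have hsumn : ∀ {i j : Fin m}, j.val = i.val + 1 →
      ∑ l ∈ Finset.Iic j, n l = n j + ∑ l ∈ Finset.Iic i, n l := by
    intro i j hij
    rw [hIic hij, Finset.sum_insert]
    simp only [Finset.mem_Iic, Fin.le_def]
    omega
  have hsuml : ∀ {i j : Fin m}, j.val = i.val + 1 →
      ∑ l ∈ Finset.Iio j, IntPartition.length (lam l) =
        IntPartition.length (lam i) + ∑ l ∈ Finset.Iio i, IntPartition.length (lam l) := by
    intro i j hij
    rw [hIio hij, Finset.sum_insert]
    simp
  have hzn : ∀ {j : Fin m}, j.val = 0 → ∑ l ∈ Finset.Iic j, n l = n j := by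
    intro j hj
    have : Finset.Iic j = {j} := by
      ext l
      simp only [Finset.mem_Iic, Finset.mem_singleton, Fin.le_def, Fin.ext_iff]
      omega
    rw [this, Finset.sum_singleton]
  have hzl : ∀ {j : Fin m}, j.val = 0 →
      ∑ l ∈ Finset.Iio j, IntPartition.length (lam l) = 0 := by
    intro j hj
    refine Finset.sum_eq_zero fun l hl => ?_
    have := Finset.mem_Iio.1 hl
    rw [Fin.lt_def] at this
    omega
  have hpred : ∀ j : Fin m, j.val = 0 ∨ ∃ i : Fin m, j.val = i.val + 1 := fun j => by
    rcases Nat.eq_zero_or_pos j.val with h | h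
    · exact Or.inl h
    · exact Or.inr ⟨⟨j.val - 1, by omega⟩, by dsimp; omega⟩
  constructor
  · intro h j
    have h1 := h.sum_eq j
    rcases hpred j with hj | ⟨i, hij⟩
    · rw [sum_splitCount_of_zero hmax hj]
      rw [hzn hj, hzl hj] at h1
      omega
    · have h2 := h.sum_eq i
      have h3 := sum_splitCount_of_succ hmax hij
      rw [hsumn hij, hsuml hij, mul_add] at h1
      omega
  · intro h
    refine ⟨fun i => ?_, hmax, fun i j hij => ?_⟩
    · obtain ⟨v, hv⟩ := i
      induction v with
      | zero =>
        have h1 := h ⟨0, hv⟩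
        rw [sum_splitCount_of_zero hmax rfl] at h1
        rw [hzn rfl, hzl rfl, h1, mul_zero, add_zero]
      | succ v ih =>
        have h1 := h ⟨v + 1, hv⟩
        have h2 := ih (by omega)
        have hij : (⟨v + 1, hv⟩ : Fin m).val = (⟨v, by omega⟩ : Fin m).val + 1 := rfl
        have h3 := sum_splitCount_of_succ hmax hij
        rw [hsumn hij, hsuml hij, mul_add]
        omega
    · have h1 := h j
      have h3 := sum_splitCount_of_succ hmax hij
      omega

end Frequencies

/-! ### The partial map of a family of disjoint paths -/

namespace SIM

variable {X : Type*}

theorem prod_map_apply_of_fix {ι : Type*} (l : List ι) (F : ι → SIM X) (D : Set X)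
    (hF : ∀ c ∈ l, ∀ x ∈ D, F c x = some x) (x : X) (hx : x ∈ D) :
    (l.map F).prod x = some x := by
  induction l with
  | nil => rfl
  | cons c l ih =>
    rw [List.map_cons, List.prod_cons]
    have h1 : (l.map F).prod x = some x := ih fun c hc => hF c (List.mem_cons_of_mem _ hc)
    exact mem_mul.2 ⟨x, h1, hF c List.mem_cons_self x hx⟩

theorem prod_map_apply_of_mem {ι : Type*} (l : List ι) (hl : l.Nodup) (F : ι → SIM X) (D : Set X)
    (c₀ : ι) (hc₀ : c₀ ∈ l) (hD : ∀ x ∈ D, ∀ y ∈ F c₀ x, y ∈ D)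
    (hF : ∀ c ∈ l, c ≠ c₀ → ∀ x ∈ D, F c x = some x) (x : X) (hx : x ∈ D) :
    (l.map F).prod x = F c₀ x := by
  induction l with
  | nil => simp at hc₀
  | cons c l ih =>
    rw [List.map_cons, List.prod_cons]
    rw [List.nodup_cons] at hl
    refine Option.ext fun z => (mem_mul (f := F c) (g := (l.map F).prod)).trans ?_
    by_cases hc : c = c₀
    · subst hc
      have h1 : (l.map F).prod x = some x := prod_map_apply_of_fix l F D
        (fun b hb => hF b (List.mem_cons_of_mem _ hb) (ne_of_mem_of_not_mem hb hl.1)) x hx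
      rw [h1]
      simp
    · have h1 := ih hl.2 ((List.mem_cons.1 hc₀).resolve_left (Ne.symm hc))
        fun b hb => hF b (List.mem_cons_of_mem _ hb)
      rw [h1]
      have h2 : ∀ y ∈ F c₀ x, F c y = some y := fun y hy =>
        hF c List.mem_cons_self hc y (hD x hx y hy)
      constructor
      · rintro ⟨y, hy, hz⟩
        rw [h2 y hy] at hz
        obtain rfl := Option.mem_some_iff.1 hz
        exact hy
      · intro hz
        exact ⟨z, hz, h2 z hz⟩

end SIM

namespace SimPath

variable {X : Type*} [DecidableEq X]

theorem toSIM_apply_of_mem (p : SimPath X) {x : X} (hx : x ∈ p.digits) :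
    p.toSIM x = p.digits[p.digits.idxOf x + 1]? :=
  if_pos hx

theorem toSIM_apply_of_notMem (p : SimPath X) {x : X} (hx : x ∉ p.digits) :
    p.toSIM x = some x :=
  if_neg hx

theorem mem_digits_of_mem_toSIM (p : SimPath X) {x y : X} (hx : x ∈ p.digits)
    (hy : y ∈ p.toSIM x) : y ∈ p.digits := by
  rw [toSIM_apply_of_mem p hx] at hy
  exact List.mem_of_getElem? hy

variable {m : ℕ} {n : Fin m → ℕ} (p : (i : Fin m) → Fin (n i) → SimPath X)

theorem prod_apply
    (hdisj : ∀ s t : (i : Fin m) × Fin (n i), s ≠ t →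
      List.Disjoint (p s.1 s.2).digits (p t.1 t.2).digits)
    (i : Fin m) (j : Fin (n i)) {x : X} (hx : x ∈ (p i j).digits) :
    (List.ofFn fun i : Fin m => (List.ofFn fun j : Fin (n i) => (p i j).toSIM).prod).prod x =
      (p i j).toSIM x := by
  have hfix : ∀ t : (i : Fin m) × Fin (n i), t ≠ ⟨i, j⟩ → ∀ y ∈ {y | y ∈ (p i j).digits},
      (p t.1 t.2).toSIM y = some y := fun t ht y hy =>
    toSIM_apply_of_notMem _ fun hy' => hdisj t ⟨i, j⟩ ht hy' hy
  have hinner : ∀ y ∈ {y | y ∈ (p i j).digits},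
      (List.ofFn fun j : Fin (n i) => (p i j).toSIM).prod y = (p i j).toSIM y := by
    intro y hy
    rw [List.ofFn_eq_map]
    refine SIM.prod_map_apply_of_mem _ (List.nodup_finRange _) _ {y | y ∈ (p i j).digits} j
      (List.mem_finRange _) (fun y hy z hz => mem_digits_of_mem_toSIM _ hy hz)
      (fun c _ hc => ?_) y hy
    exact hfix ⟨i, c⟩ fun h => hc (by simpa using h)
  rw [List.ofFn_eq_map, SIM.prod_map_apply_of_mem _ (List.nodup_finRange _) _
    {y | y ∈ (p i j).digits} i (List.mem_finRange _) ?_ ?_ x hx]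
  · exact hinner x hx
  · intro y hy z hz
    rw [hinner y hy] at hz
    exact mem_digits_of_mem_toSIM _ hy hz
  · intro c _ hc y hy
    rw [List.ofFn_eq_map]
    refine SIM.prod_map_apply_of_fix _ _ {y | y ∈ (p i j).digits} (fun b _ => ?_) y hy
    exact hfix ⟨c, b⟩ fun h => hc (congrArg Sigma.fst h)

theorem exists_isChart_prod
    (hdisj : ∀ s t : (i : Fin m) × Fin (n i), s ≠ t →
      List.Disjoint (p s.1 s.2).digits (p t.1 t.2).digits)
    (hcover : ∀ x : X, ∃ (i : Fin m) (j : Fin (n i)), x ∈ (p i j).digits) :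
    ∃ f : X → (Σ i, Fin (n i)) × ℕ, SIM.IsChart
      (List.ofFn fun i : Fin m => (List.ofFn fun j : Fin (n i) => (p i j).toSIM).prod).prod
      (fun s => (p s.1 s.2).length) f := by
  have hex : ∀ x : X, ∃ s : Σ i, Fin (n i), x ∈ (p s.1 s.2).digits := fun x => by
    obtain ⟨i, j, h⟩ := hcover x
    exact ⟨⟨i, j⟩, h⟩
  choose b hb using hex
  have huniq : ∀ (x : X) (s : Σ i, Fin (n i)), x ∈ (p s.1 s.2).digits → b x = s := by
    intro x s hs
    by_contra hne
    exact hdisj _ _ hne (hb x) hs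
  have hget : ∀ (x : X) (s : Σ i, Fin (n i)) (q : ℕ), (p s.1 s.2).digits[q]? = some x ↔
      (b x, (p (b x).1 (b x).2).digits.idxOf x) = (s, q) := by
    intro x s q
    constructor
    · intro h
      have h1 := huniq x s (List.mem_of_getElem? h)
      subst h1
      obtain ⟨hq, h2⟩ := List.getElem?_eq_some_iff.1 h
      refine Prod.ext rfl ?_
      have h3 := (p (b x).1 (b x).2).nodup.idxOf_getElem q hq
      rwa [h2] at h3
    · intro h
      obtain ⟨rfl, rfl⟩ := Prod.ext_iff.1 h
      exact List.getElem?_idxOf (hb x)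
  refine ⟨fun x => (b x, (p (b x).1 (b x).2).digits.idxOf x), fun x y hxy => ?_,
    fun s q => ?_, fun x y => ?_⟩
  · have h1 := (hget x _ _).2 rfl
    have h2 := (hget y _ _).2 hxy.symm
    exact Option.some_inj.1 (h1.symm.trans h2)
  · simp only [← hget]
    constructor
    · rintro ⟨x, hx⟩
      exact (List.getElem?_eq_some_iff.1 hx).1
    · intro h
      exact ⟨_, List.getElem?_eq_getElem h⟩
  · dsimp only
    rw [← hget, Option.mem_def, prod_apply p hdisj (b x).1 (b x).2 (hb x),
      toSIM_apply_of_mem _ (hb x)]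

end SimPath

namespace SIM

variable {X Y S : Type*}

instance [Finite X] : Finite (SIM X) := DFunLike.finite _

theorem notMem_pow_of_le {α : SIM X} {N q : ℕ} (hN : ∀ x y, y ∉ (α ^ N) x) (hq : N ≤ q)
    (x y : X) : y ∉ (α ^ q) x := by
  obtain ⟨d, rfl⟩ := Nat.exists_eq_add_of_le hq
  rw [add_comm, pow_add, mem_mul]
  rintro ⟨z, hz, -⟩
  exact hN _ _ hz

theorem pathCount_eq_zero {α : SIM X} {N q : ℕ} (hN : ∀ x y, y ∉ (α ^ N) x) (hq : N ≤ q) :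
    pathCount α q = 0 := by
  have : IsEmpty {x // (¬ ∃ w, x ∈ α w) ∧ (∃ y, y ∈ (α ^ q) x) ∧
      ¬ ∃ y, y ∈ (α ^ (q + 1)) x} := by
    refine ⟨?_⟩
    rintro ⟨x, -, ⟨y, hy⟩, -⟩
    exact notMem_pow_of_le hN hq _ _ hy
  exact Nat.card_of_isEmpty

theorem IsChart.le_of_notMem_pow {α : SIM X} {h : S → ℕ} {f : X → S × ℕ} (hf : IsChart α h f)
    (hpos : ∀ s, 0 < h s) {N : ℕ} (hN : ∀ x y, y ∉ (α ^ N) x) (s : S) : h s ≤ N := by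
  by_contra hlt
  obtain ⟨x, hx⟩ := hf.exists_eq (hpos s)
  obtain ⟨y, hy⟩ := (hf.exists_mem_pow_iff N x).2 (by rw [hx]; dsimp only; omega)
  exact hN _ _ hy

theorem card_sigma_fst_eq {ι : Type*} (d : ι → ℕ) (b : ι) :
    Nat.card {s : Σ c, Fin (d c) // s.1 = b} = d b := by
  rw [Nat.card_congr (Equiv.sigmaSubtype b), Nat.card_fin]

theorem card_comp_perm_eq {ι : Type*} [Fintype ι] (d : ι → ℕ) {h : ι → ℕ}
    (hh : Function.Injective h) :
    Nat.card {g : Equiv.Perm (Σ c, Fin (d c)) // (fun s => h s.1) ∘ g = fun s => h s.1} =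
      ∏ c, (d c).factorial := by
  classical
  have h1 : ∀ g : Equiv.Perm (Σ c, Fin (d c)), (fun s => h s.1) ∘ g = (fun s => h s.1) ↔
      Sigma.fst ∘ g = Sigma.fst := fun g => by
    simp only [funext_iff, Function.comp_apply, hh.eq_iff]
  simp only [h1]
  rw [Nat.card_eq_fintype_card, DomMulAct.stabilizer_card]
  refine Finset.prod_congr rfl fun c _ => ?_
  rw [← Nat.card_eq_fintype_card, card_sigma_fst_eq]

/-- The numbers of paths of `α`, indexed as the frequencies of the parts of a chain. -/
noncomputable def pathFreq {m k : ℕ} (α : SIM X) (c : Fin m × Fin k) : ℕ :=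
  pathCount α (rootLength c - 1)

theorem rootLength_sub_one_add_one {m k : ℕ} (c : Fin m × Fin k) :
    rootLength c - 1 + 1 = rootLength c :=
  Nat.sub_add_cancel (Nat.succ_pos _)

theorem IsChart.pathFreq_eq {m k : ℕ} {α : SIM X} {c : S → Fin m × Fin k} {f : X → S × ℕ}
    (hf : IsChart α (fun s => rootLength (c s)) f) (b : Fin m × Fin k) :
    pathFreq α b = Nat.card {s // c s = b} := by
  unfold pathFreq
  rw [hf.pathCount_eq, rootLength_sub_one_add_one]
  simp only [rootLength_injective.eq_iff]

theorem pathCount_pow_rev [Finite X] {m k : ℕ} (hk : 0 < k) {α : SIM X}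
    (hα : ∀ x y, y ∉ (α ^ (k * m)) x) (j : Fin m) :
    pathCount (α ^ k) j.rev = ∑ b : Fin m × Fin k, pathFreq α b * splitCount j b := by
  obtain ⟨h, f, hf, hpos⟩ := exists_isChart hα
  have h1 : ∀ s, ∃ c : Fin m × Fin k, rootLength c = h s := fun s =>
    exists_rootLength_eq hk (hpos s) (by rw [mul_comm]; exact hf.le_of_notMem_pow hpos hα s)
  choose c hc using h1
  obtain rfl : (fun s => rootLength (c s)) = h := funext hc
  rw [hf.pathCount_pow hk]
  simp only [hf.pathFreq_eq]

theorem pathCount_conj (e : X ≃ Y) (α : SIM X) (q : ℕ) :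
    pathCount (conj e α) q = pathCount α q := by
  unfold pathCount
  have h1 : ∀ (j : ℕ) (x : X), (∃ y, y ∈ (conj e α ^ j) (e x)) ↔ ∃ y, y ∈ (α ^ j) x := by
    intro j x
    rw [← conj_pow, e.surjective.exists]
    exact exists_congr fun y => conj_eq_iff.1 rfl x y
  have h2 : ∀ x, (∃ w, e x ∈ conj e α w) ↔ ∃ w, x ∈ α w := by
    intro x
    rw [e.surjective.exists]
    exact exists_congr fun y => conj_eq_iff.1 rfl y x
  exact (Nat.card_congr (e.subtypeEquiv fun x => by rw [h1, h1, h2])).symm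

theorem pathCount_eq_of_pathFreq_eq {m k : ℕ} (hk : 0 < k) {α : SIM X} {β : SIM Y}
    (hα : ∀ x y, y ∉ (α ^ (k * m)) x) (hβ : ∀ x y, y ∉ (β ^ (k * m)) x)
    (h : ∀ c : Fin m × Fin k, pathFreq α c = pathFreq β c) (q : ℕ) :
    pathCount α q = pathCount β q := by
  by_cases hq : q < k * m
  · obtain ⟨c, hc⟩ := exists_rootLength_eq (m := m) (L := q + 1) hk (Nat.succ_pos q)
      (by rw [mul_comm]; exact hq)
    have := h c
    unfold pathFreq at this
    rwa [hc] at this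
  · rw [pathCount_eq_zero hα (not_lt.1 hq), pathCount_eq_zero hβ (not_lt.1 hq)]

section Roots

variable {m k : ℕ} {n : Fin m → ℕ} {σ : SIM X} {f : X → (Σ i, Fin (n i)) × ℕ}

theorem IsChart.pathCount_rev (hσ : IsChart σ (fun s : Σ i, Fin (n i) => s.1.rev.val + 1) f)
    (j : Fin m) : pathCount σ j.rev = n j := by
  rw [hσ.pathCount_eq]
  simp only [add_left_inj, Fin.val_inj, Fin.rev_inj]
  exact card_sigma_fst_eq n j

theorem IsChart.root_notMem_pow
    (hσ : IsChart σ (fun s : Σ i, Fin (n i) => s.1.rev.val + 1) f) {α : SIM X} (hα : α ^ k = σ)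
    (x y : X) : y ∉ (α ^ (k * m)) x := by
  rw [pow_mul, hα]
  exact hσ.notMem_pow (fun s => s.1.rev.2) x y

/-- The number of roots with given path frequencies. -/
theorem IsChart.card_roots_mul [Finite X] (hk : 0 < k)
    (hσ : IsChart σ (fun s : Σ i, Fin (n i) => s.1.rev.val + 1) f) {d : Fin m × Fin k → ℕ}
    (hd : ∀ j, ∑ c, d c * splitCount j c = n j) :
    Nat.card {α : SIM X // α ^ k = σ ∧ pathFreq α = d} * ∏ c, (d c).factorial =
      ∏ i, (n i).factorial := by
  obtain ⟨β, hβ⟩ := exists_model fun s : Σ c, Fin (d c) => rootLength s.1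
  have hle : ∀ s : Σ c, Fin (d c), rootLength s.1 ≤ k * m := by
    rintro ⟨⟨i, a⟩, -⟩
    have h1 : (i.rev.val + 1) * k ≤ m * k := Nat.mul_le_mul_right k i.rev.2
    have ha := a.2
    unfold rootLength
    rw [add_mul, one_mul] at h1
    rw [mul_comm k m]
    dsimp only
    omega
  have hβN := hβ.notMem_pow hle
  have hβf : pathFreq β = d := funext fun b => by rw [hβ.pathFreq_eq, card_sigma_fst_eq]
  have hσN : ∀ x y, y ∉ (σ ^ m) x := hσ.notMem_pow fun s => s.1.rev.2
  have hβN' : ∀ x y, y ∉ ((β ^ k) ^ m) x := by rwa [← pow_mul]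
  obtain ⟨e₀, he₀⟩ : ∃ e : (Σ s : Σ c, Fin (d c), Fin (rootLength s.1)) ≃ X,
      conj e (β ^ k) = σ := by
    refine exists_conj_eq_of_pathCount_eq hβN' hσN fun q => ?_
    by_cases hq : q < m
    · obtain ⟨j, hj⟩ : ∃ j : Fin m, j.rev.val = q := ⟨Fin.rev ⟨q, hq⟩, by rw [Fin.rev_rev]⟩
      rw [← hj, pathCount_pow_rev hk hβN, hσ.pathCount_rev, hβf, hd]
    · rw [pathCount_eq_zero hβN' (not_lt.1 hq), pathCount_eq_zero hσN (not_lt.1 hq)]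
  have key := card_conj_roots_mul he₀
  rw [hβ.card_centralizer (fun s => Nat.succ_pos _), hσ.card_centralizer fun s => Nat.succ_pos _,
    card_comp_perm_eq d rootLength_injective,
    card_comp_perm_eq n (h := fun i => i.rev.val + 1)
      (fun i j hij => Fin.rev_injective (Fin.ext (Nat.succ_injective hij)))] at key
  rw [← key]
  congr 1
  refine Nat.card_congr (Equiv.subtypeEquivRight fun α => and_congr_right fun hα => ?_)
  constructor
  · intro h
    exact exists_conj_eq_of_pathCount_eq hβN (hσ.root_notMem_pow hα)
      (pathCount_eq_of_pathFreq_eq hk hβN (hσ.root_notMem_pow hα) fun c => by rw [hβf, h])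
  · rintro ⟨e, rfl⟩
    exact (funext fun c => pathCount_conj e β _).trans hβf

theorem IsChart.chainOfFreq_mem [Finite X] (hk : 0 < k)
    (hσ : IsChart σ (fun s : Σ i, Fin (n i) => s.1.rev.val + 1) f) {α : SIM X} (hα : α ^ k = σ) :
    chainOfFreq (pathFreq (m := m) (k := k) α) ∈ admissibleChains k n := by
  refine (Set.Finite.mem_toFinset _).2 ((isAdmissibleChain_iff
    (fun i _ => le_of_mem_chainOfFreq _ i) n).2 fun j => ?_)
  rw [chainFreq_chainOfFreq, ← pathCount_pow_rev hk (hσ.root_notMem_pow hα), hα,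
    hσ.pathCount_rev]

theorem IsChart.rootCount_eq [Finite X] (hk : 0 < k)
    (hσ : IsChart σ (fun s : Σ i, Fin (n i) => s.1.rev.val + 1) f) :
    (rootCount k σ : ℚ) = ∑ lam ∈ admissibleChains k n,
      (∏ i, ((n i).factorial : ℚ)) / ∏ i, (IntPartition.freqFactorialProd (lam i) : ℚ) := by
  classical
  have := Fintype.ofFinite (SIM X)
  have h1 : rootCount k σ = ∑ lam ∈ admissibleChains k n,
      Nat.card {α : SIM X // α ^ k = σ ∧ pathFreq α = chainFreq k lam} := by
    unfold rootCount
    rw [Nat.card_eq_fintype_card, Fintype.card_subtype,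
      Finset.card_eq_sum_card_fiberwise (t := admissibleChains k n)
        (f := fun α => chainOfFreq (pathFreq (m := m) (k := k) α))
        fun α hα => hσ.chainOfFreq_mem hk (by simpa using hα)]
    refine Finset.sum_congr rfl fun lam hlam => ?_
    have hadm : IsAdmissibleChain k n lam := (Set.Finite.mem_toFinset _).1 hlam
    rw [Finset.filter_filter, Nat.card_eq_fintype_card, Fintype.card_subtype]
    congr 1
    refine Finset.filter_congr fun α _ => and_congr_right fun _ => ?_
    constructor
    · rintro rfl
      rw [chainFreq_chainOfFreq]
    · intro h
      rw [h]
      exact eq_of_chainFreq_eq (fun i _ => le_of_mem_chainOfFreq _ i) hadm.max_le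
        (chainFreq_chainOfFreq _)
  rw [h1, Nat.cast_sum]
  refine Finset.sum_congr rfl fun lam hlam => ?_
  have hadm : IsAdmissibleChain k n lam := (Set.Finite.mem_toFinset _).1 hlam
  have h2 := hσ.card_roots_mul hk ((isAdmissibleChain_iff hadm.max_le n).1 hadm)
  have h3 : ∏ i, IntPartition.freqFactorialProd (lam i) =
      ∏ c, (chainFreq k lam c).factorial := by
    rw [Fintype.prod_prod_type]
    exact Finset.prod_congr rfl fun i _ => freqFactorialProd_eq hadm.max_le i
  rw [← h3] at h2
  have h4 : (∏ i, (IntPartition.freqFactorialProd (lam i) : ℚ)) ≠ 0 :=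
    Finset.prod_ne_zero_iff.2 fun i _ => Nat.cast_ne_zero.2
      (Finset.prod_ne_zero_iff.2 fun a _ => Nat.factorial_ne_zero _)
  rw [eq_div_iff h4]
  exact_mod_cast h2

end Roots

end SIM

theorem theorem4 {X : Type*} [Fintype X] [DecidableEq X] (k : ℕ) (hk : 0 < k)
    (m : ℕ) (hm : 2 ≤ m) (n : Fin m → ℕ)
    (p : (i : Fin m) → Fin (n i) → SimPath X)
    (hlen : ∀ (i : Fin m) (j : Fin (n i)), (p i j).length + i.val = m)
    (hdisj : ∀ s t : (i : Fin m) × Fin (n i), s ≠ t →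
      List.Disjoint (p s.1 s.2).digits (p t.1 t.2).digits)
    (hcover : ∀ x : X, ∃ (i : Fin m) (j : Fin (n i)), x ∈ (p i j).digits)
    (σ : SIM X)
    (hσ : σ = (List.ofFn fun i : Fin m =>
      (List.ofFn fun j : Fin (n i) => (p i j).toSIM).prod).prod) :
    (SIM.rootCount k σ : ℚ) =
      ∑ lam ∈ admissibleChains k n,
        (∏ i, ((n i).factorial : ℚ)) /
          ∏ i, (IntPartition.freqFactorialProd (lam i) : ℚ) := by
  obtain ⟨f, hf⟩ := SimPath.exists_isChart_prod p hdisj hcover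
  have hlength : (fun s : Σ i, Fin (n i) => (p s.1 s.2).length) =
      fun s => s.1.rev.val + 1 := by
    funext ⟨i, j⟩
    have h1 := hlen i j
    have h2 := i.2
    dsimp only
    rw [Fin.val_rev]
    omega
  rw [hlength, ← hσ] at hf
  exact hf.rootCount_eq hk
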